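/- Let $\mathcal{D}$ be the poset of Turing degrees, that is, the set of subsets of $\omega$ modulo Turing equivalence, ordered by Turing reducibility, and let $\mathcal{D}^+ \subset \mathcal{D}$ be the sub-poset of the degrees of noncomputable sets. For a poset $P$, call $F \subset P$ a comparable family if for every $p \in P$ there is $q \in F$ with $p \le q$ or $q \le p$, and an incomparable family if for every $p \in P$ there is $q \in F$ with $p \not\le q$ and $q \not\le p$. Let $\mathfrak{cp}(P)$ be the least cardinality of a comparable family of $P$, and let $\mathfrak{icp}(P)$ be the least cardinality of an incomparable family of $P$ (defined if such a family exists). Then $\mathfrak{cp}(\mathcal{D}^+) = \mathfrak{c} = 2^{\aleph_0}$; moreover $\mathfrak{icp}(\mathcal{D}^+)$ is defined, and $\mathfrak{icp}(\mathcal{D}^+) = \aleph_1$. -/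

import Mathlib

open scoped Cardinal

/-- `F` is a comparable family of `P`: every element of `P` is comparable to a member of `F`. -/
def IsComparableFamily {P : Type*} [PartialOrder P] (F : Set P) : Prop :=
  ∀ p : P, ∃ q ∈ F, p ≤ q ∨ q ≤ p

/-- `F` is an incomparable family of `P`: every element of `P` is incomparable to a member
of `F`. -/
def IsIncomparableFamily {P : Type*} [PartialOrder P] (F : Set P) : Prop :=
  ∀ p : P, ∃ q ∈ F, ¬ p ≤ q ∧ ¬ q ≤ p

/-- The comparability number: the least size of a comparable family
(`P` itself is one, so the minimum exists). -/
noncomputable def comparabilityNumber (P : Type*) [PartialOrder P] : Cardinal :=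
  sInf {κ | ∃ F : Set P, IsComparableFamily F ∧ #F = κ}

/-- The incomparability number: the least size of an incomparable family. It is meaningful only
when some incomparable family exists. -/
noncomputable def incomparabilityNumber (P : Type*) [PartialOrder P] : Cardinal :=
  sInf {κ | ∃ F : Set P, IsIncomparableFamily F ∧ #F = κ}

/-- The characteristic function of a set of natural numbers, as an (everywhere defined)
partial function. -/
noncomputable def charFun (A : Set ℕ) : ℕ →. ℕ :=
  fun n => Part.some (A.indicator (fun _ => 1) n)

/-- `A ≤_T B`: the characteristic function of `A` is recursive in that of `B`. -/
def SetTuringLE (A B : Set ℕ) : Prop :=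
  TuringReducible (charFun A) (charFun B)

/-- Turing reducibility of sets as a preorder (not an instance: the order on `Set ℕ` is `⊆`). -/
abbrev setTuringPreorder : Preorder (Set ℕ) where
  le := SetTuringLE
  lt A B := SetTuringLE A B ∧ ¬ SetTuringLE B A
  le_refl A := TuringReducible.refl (charFun A)
  le_trans _ _ _ h₁ h₂ := TuringReducible.trans h₁ h₂

instance SetTuringLE.instIsPreorder : IsPreorder (Set ℕ) SetTuringLE where
  refl := setTuringPreorder.le_refl
  trans := setTuringPreorder.le_trans

/-- The Turing degrees: sets of natural numbers modulo mutual Turing reducibility.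
(Mathlib's `TuringDegree` is a quotient of all *partial* functions, hence not used.) -/
def SetTuringDegree : Type :=
  Antisymmetrization (Set ℕ) SetTuringLE

/-- The order of Turing degrees induced by Turing reducibility. -/
instance SetTuringDegree.instPartialOrder : PartialOrder SetTuringDegree :=
  @instPartialOrderAntisymmetrization (Set ℕ) setTuringPreorder

/-- The Turing degree of a set of natural numbers. -/
def SetTuringDegree.deg (A : Set ℕ) : SetTuringDegree :=
  toAntisymmetrization SetTuringLE A

theorem SetTuringDegree.deg_le_deg {A B : Set ℕ} :
    SetTuringDegree.deg A ≤ SetTuringDegree.deg B ↔ SetTuringLE A B :=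
  Iff.rfl

/-- The poset of incomputable Turing degrees: the degrees of the sets that are not computable,
with the induced order. -/
abbrev IncomputableDegree : Type :=
  {a : SetTuringDegree // ∃ A : Set ℕ, SetTuringDegree.deg A = a ∧ ¬ ComputablePred (· ∈ A)}

/-! The core is a set `T` of continuum many noncomputable degrees such that no noncomputable degree
lies below two of them (`exists_pairwise_minimal_pairs`). A degree bounds only countably many
degrees and lies below at most one member of `T`, so it is comparable to only countably many
members. Hence a comparable family has at least `#T` elements, and every uncountable subset of `T`
is an incomparable family. A countable family is never incomparable, because an effective join
bounds it. `T` comes from a perfect tree of sequences meeting, for any two functionals, a dense open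
condition: either they already disagree, or no extensions make them disagree. In the second case a
set computed by both can be found by searching through extensions, so it is computable. -/

open Encodable Filter

/-! ### Use principle and countability of lower cones -/

/-- `y` is the limit of the increasing sequence `x` of partial values. -/
structure Part.IsMonoLimit {α : Type*} (x : ℕ → Part α) (y : Part α) : Prop where
  mono : ∀ {k l a}, k ≤ l → a ∈ x k → a ∈ x l
  mem_iff : ∀ {a}, a ∈ y ↔ ∃ k, a ∈ x k

namespace Part.IsMonoLimit

variable {α β : Type*}

theorem const (y : Part α) : IsMonoLimit (fun _ => y) y :=
  ⟨fun _ h => h, by simp⟩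

theorem eventually {x : ℕ → Part α} {y : Part α} (h : IsMonoLimit x y) {a : α} (ha : a ∈ y) :
    ∀ᶠ k in atTop, a ∈ x k := by
  obtain ⟨k, hk⟩ := h.mem_iff.1 ha
  filter_upwards [eventually_ge_atTop k] with l hl using h.mono hl hk

theorem bind {x : ℕ → Part α} {y : Part α} {f : ℕ → α → Part β} {g : α → Part β}
    (h : IsMonoLimit x y) (hf : ∀ a, IsMonoLimit (fun k => f k a) (g a)) :
    IsMonoLimit (fun k => (x k).bind (f k)) (y.bind g) where
  mono hkl := by
    simp only [Part.mem_bind_iff]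
    rintro ⟨b, hb, ha⟩
    exact ⟨b, h.mono hkl hb, (hf b).mono hkl ha⟩
  mem_iff {a} := by
    simp only [Part.mem_bind_iff]
    constructor
    · rintro ⟨b, hb, ha⟩
      obtain ⟨k, hk⟩ := ((h.eventually hb).and ((hf b).eventually ha)).exists
      exact ⟨k, b, hk⟩
    · rintro ⟨k, b, hb, ha⟩
      exact ⟨b, h.mem_iff.2 ⟨k, hb⟩, (hf b).mem_iff.2 ⟨k, ha⟩⟩

theorem map {x : ℕ → Part α} {y : Part α} (f : α → β) (h : IsMonoLimit x y) :
    IsMonoLimit (fun k => (x k).map f) (y.map f) := by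
  simp only [← Part.bind_some_eq_map]
  exact h.bind fun a => const (Part.some (f a))

/-- A terminating search consults finitely many values, so a single stage suffices for all of them.
-/
theorem rfind {p : ℕ → ℕ →. Bool} {q : ℕ →. Bool}
    (h : ∀ n, IsMonoLimit (fun k => p k n) (q n)) :
    IsMonoLimit (fun k => Nat.rfind (p k)) (Nat.rfind q) where
  mono hkl := by
    simp only [Nat.mem_rfind]
    exact fun ⟨h₁, h₂⟩ => ⟨(h _).mono hkl h₁, fun hm => (h _).mono hkl (h₂ hm)⟩
  mem_iff {n} := by
    simp only [Nat.mem_rfind]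
    constructor
    · rintro ⟨h₁, h₂⟩
      have h₃ : ∀ᶠ k in atTop, ∀ m ∈ Set.Iio n, false ∈ p k m :=
        (eventually_all_finite (Set.finite_Iio n)).2 fun m hm => (h m).eventually (h₂ hm)
      obtain ⟨k, hk₁, hk₂⟩ := (((h n).eventually h₁).and h₃).exists
      exact ⟨k, hk₁, fun hm => hk₂ _ hm⟩
    · rintro ⟨k, h₁, h₂⟩
      exact ⟨(h _).mem_iff.2 ⟨k, h₁⟩, fun hm => (h _).mem_iff.2 ⟨k, h₂ hm⟩⟩

end Part.IsMonoLimit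

/-- The initial segment of length `k` of a binary sequence. -/
def initialSegment (X : ℕ → Bool) (k : ℕ) : List Bool :=
  (List.range k).map X

theorem length_initialSegment (X : ℕ → Bool) (k : ℕ) : (initialSegment X k).length = k := by
  simp [initialSegment]

theorem getElem?_initialSegment (X : ℕ → Bool) {k n : ℕ} (h : n < k) :
    (initialSegment X k)[n]? = some (X n) := by
  simp [initialSegment, h]

theorem initialSegment_prefix (X : ℕ → Bool) {k l : ℕ} (h : k ≤ l) :
    initialSegment X k <+: initialSegment X l := by
  obtain ⟨m, rfl⟩ := Nat.exists_eq_add_of_le h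
  simp [initialSegment, List.range_add]

/-- The set of natural numbers with characteristic function `X`. -/
def setOfSeq (X : ℕ → Bool) : Set ℕ :=
  {n | X n = true}

theorem setOfSeq_surjective : Function.Surjective setOfSeq := by
  classical
  exact fun A => ⟨fun n => decide (n ∈ A), by ext; simp [setOfSeq]⟩

theorem charFun_setOfSeq (X : ℕ → Bool) (n : ℕ) :
    charFun (setOfSeq X) n = Part.some (cond (X n) 1 0) := by
  cases h : X n <;> simp [charFun, setOfSeq, h]

/-- A uniform family of partial recursive functions `h σ`, indexed by finite binary strings `σ`,
approximates `f` along `X` if `f` is the increasing limit of `h σ` as `σ` runs through the initial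
segments of `X`. -/
def ApproximatesAlong (X : ℕ → Bool) (h : List Bool → ℕ →. ℕ) (f : ℕ →. ℕ) : Prop :=
  ∀ n, Part.IsMonoLimit (fun k => h (initialSegment X k) n) (f n)

theorem approximatesAlong_oracle (X : ℕ → Bool) :
    ApproximatesAlong X (fun σ n => ((σ[n]?).map fun b => cond b 1 0 : Option ℕ))
      (charFun (setOfSeq X)) := by
  intro n
  rw [charFun_setOfSeq]
  have key : ∀ k a, a ∈ (((initialSegment X k)[n]?.map fun b => cond b 1 0 : Option ℕ) : Part ℕ) ↔
      n < k ∧ a = cond (X n) 1 0 := by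
    intro k a
    rcases lt_or_ge n k with h | h
    · simp [getElem?_initialSegment X h, h]
    · simp [List.getElem?_eq_none (length_initialSegment X k ▸ h), h]
  refine ⟨fun {k l a} hkl => ?_, fun {a} => ?_⟩
  · simp only [key]
    exact fun h => ⟨h.1.trans_le hkl, h.2⟩
  · simp only [key]
    exact ⟨fun h => ⟨n + 1, n.lt_succ_self, by simpa using h⟩, fun ⟨_, h⟩ => by simpa using h.2⟩

/-- Use principle: a function recursive in `X` is uniformly approximated by a partial recursive
functional evaluated on the initial segments of `X`. -/
theorem exists_partrec_approximatesAlong (X : ℕ → Bool) {f : ℕ →. ℕ}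
    (hf : TuringReducible f (charFun (setOfSeq X))) :
    ∃ h : List Bool → ℕ →. ℕ, Partrec₂ h ∧ ApproximatesAlong X h f := by
  have of_partrec : ∀ {g : ℕ →. ℕ}, Nat.Partrec g →
      ∃ h : List Bool → ℕ →. ℕ, Partrec₂ h ∧ ApproximatesAlong X h g := fun {g} hg =>
    ⟨fun _ => g, (Partrec.nat_iff.2 hg).comp Computable.snd, fun n => .const _⟩
  rw [TuringReducible, RecursiveIn.iff_nat] at hf
  -- Each closure operation is applied to the approximations uniformly in `σ`, and preserves
  -- increasing limits.
  induction hf with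
  | zero => exact of_partrec .zero
  | succ => exact of_partrec .succ
  | left => exact of_partrec .left
  | right => exact of_partrec .right
  | oracle g hg =>
    obtain rfl := Set.mem_singleton_iff.1 hg
    refine ⟨_, ?_, approximatesAlong_oracle X⟩
    refine Computable.ofOption (Primrec.to_comp ?_)
    exact Primrec.option_map (Primrec.list_getElem?.comp Primrec.fst Primrec.snd)
      (Primrec.cond Primrec.snd (Primrec.const 1) (Primrec.const 0)).to₂
  | @pair f g _ _ ihf ihg =>
    obtain ⟨a, ha, ha'⟩ := ihf
    obtain ⟨b, hb, hb'⟩ := ihg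
    refine ⟨fun σ n => (a σ n).bind fun x => (b σ n).map (Nat.pair x), ?_, fun n => ?_⟩
    · have h₁ : Partrec fun r : (List Bool × ℕ) × ℕ => b r.1.1 r.1.2 :=
        hb.comp (Computable.fst.comp Computable.fst) (Computable.snd.comp Computable.fst)
      have h₂ : Primrec fun r : ((List Bool × ℕ) × ℕ) × ℕ => Nat.pair r.1.2 r.2 :=
        Primrec₂.natPair.comp (Primrec.snd.comp Primrec.fst) Primrec.snd
      exact Partrec.bind ha (h₁.map h₂.to_comp.to₂).to₂
    · simpa [Seq.seq] using (ha' n).bind fun x => (hb' n).map (Nat.pair x)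
  | @comp f g _ _ ihf ihg =>
    obtain ⟨a, ha, ha'⟩ := ihf
    obtain ⟨b, hb, hb'⟩ := ihg
    refine ⟨fun σ n => (b σ n).bind (a σ), ?_, fun n => (hb' n).bind ha'⟩
    exact Partrec.bind hb (ha.comp (Computable.fst.comp Computable.fst) Computable.snd).to₂
  | @prec f g _ _ ihf ihg =>
    obtain ⟨a, ha, ha'⟩ := ihf
    obtain ⟨b, hb, hb'⟩ := ihg
    refine ⟨fun σ p => p.unpair.2.rec (a σ p.unpair.1) fun y IH =>
      IH.bind fun i => b σ (Nat.pair p.unpair.1 (Nat.pair y i)), ?_, fun p => ?_⟩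
    · refine Partrec.nat_rec (f := fun q : List Bool × ℕ => q.2.unpair.2)
        (g := fun q => a q.1 q.2.unpair.1)
        (h := fun q r => b q.1 (Nat.pair q.2.unpair.1 (Nat.pair r.1 r.2))) ?_ ?_ ?_
      · exact (Primrec.snd.comp (Primrec.unpair.comp Primrec.snd)).to_comp
      · exact ha.comp Computable.fst
          (Primrec.fst.comp (Primrec.unpair.comp Primrec.snd)).to_comp
      · have : Primrec fun r : (List Bool × ℕ) × (ℕ × ℕ) =>
            Nat.pair r.1.2.unpair.1 (Nat.pair r.2.1 r.2.2) :=
          Primrec₂.natPair.comp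
            (Primrec.fst.comp (Primrec.unpair.comp (Primrec.snd.comp Primrec.fst)))
            (Primrec₂.natPair.comp (Primrec.fst.comp Primrec.snd) (Primrec.snd.comp Primrec.snd))
        exact (hb.comp (Computable.fst.comp Computable.fst) this.to_comp).to₂
    · simp only
      induction p.unpair.2 with
      | zero => exact ha' _
      | succ y ih => exact ih.bind fun i => hb' _
  | @rfind f _ ihf =>
    obtain ⟨a, ha, ha'⟩ := ihf
    refine ⟨fun σ n => Nat.rfind fun m => (a σ (Nat.pair n m)).map fun m => decide (m = 0), ?_,
      fun n => .rfind fun m => (ha' _).map _⟩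
    have h₁ : Primrec fun r : (List Bool × ℕ) × ℕ => Nat.pair r.1.2 r.2 :=
      Primrec₂.natPair.comp (Primrec.snd.comp Primrec.fst) Primrec.snd
    have h₂ : Primrec fun r : ((List Bool × ℕ) × ℕ) × ℕ => decide (r.2 = 0) :=
      Primrec.eq.decide.comp Primrec.snd (Primrec.const 0)
    have h₃ : Partrec fun r : (List Bool × ℕ) × ℕ => a r.1.1 (Nat.pair r.1.2 r.2) :=
      ha.comp (Computable.fst.comp Computable.fst) h₁.to_comp
    exact Partrec.rfind (h₃.map h₂.to_comp.to₂).to₂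

/-- The partial recursive functional with code `c`. -/
def Nat.Partrec.Code.functional (c : Nat.Partrec.Code) (σ : List Bool) : ℕ →. ℕ :=
  fun n => c.eval (encode (σ, n))

theorem exists_code_approximatesAlong (X : ℕ → Bool) {f : ℕ →. ℕ}
    (hf : TuringReducible f (charFun (setOfSeq X))) :
    ∃ c : Nat.Partrec.Code, ApproximatesAlong X c.functional f := by
  obtain ⟨h, hh, hX⟩ := exists_partrec_approximatesAlong X hf
  obtain ⟨c, hc⟩ := Nat.Partrec.Code.exists_code.1 hh
  have : c.functional = h := by
    funext σ n
    simp [Nat.Partrec.Code.functional, hc, Part.map_id']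
  exact ⟨c, this ▸ hX⟩

theorem ApproximatesAlong.unique {X : ℕ → Bool} {h : List Bool → ℕ →. ℕ} {f g : ℕ →. ℕ}
    (hf : ApproximatesAlong X h f) (hg : ApproximatesAlong X h g) : f = g := by
  funext n
  ext a
  rw [(hf n).mem_iff, (hg n).mem_iff]

theorem charFun_injective : Function.Injective charFun := by
  intro A B h
  ext n
  have := congrFun h n
  by_cases hA : n ∈ A <;> by_cases hB : n ∈ B <;> simp_all [charFun]

/-- Along a fixed oracle sequence, a code approximates at most one function. -/
theorem countable_setOf_setTuringLE (B : Set ℕ) : {A | SetTuringLE A B}.Countable := by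
  obtain ⟨X, rfl⟩ := setOfSeq_surjective B
  choose c hc using fun A : {A | SetTuringLE A (setOfSeq X)} =>
    exists_code_approximatesAlong X A.2
  refine Function.Injective.countable (f := c) fun A A' h => ?_
  exact Subtype.ext (charFun_injective ((hc A).unique (h ▸ hc A')))

theorem computablePred_iff_partrec_charFun {A : Set ℕ} :
    ComputablePred (· ∈ A) ↔ Partrec (charFun A) := by
  classical
  constructor
  · rintro ⟨_, h⟩
    refine Partrec.of_eq (Computable.cond h (.const 1) (.const 0)).partrec fun n => ?_
    by_cases hn : n ∈ A <;> simp [charFun, hn]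
  · intro h
    have h' : Computable (A.indicator fun _ => 1) := h
    refine ⟨inferInstance, ((Primrec.eq (α := ℕ)).decide.to_comp.comp h' (.const 1)).of_eq
      fun n => ?_⟩
    by_cases hn : n ∈ A <;> simp [hn]

theorem SetTuringLE.computablePred {A B : Set ℕ} (h : SetTuringLE A B)
    (hB : ComputablePred (· ∈ B)) : ComputablePred (· ∈ A) := by
  rw [computablePred_iff_partrec_charFun] at hB ⊢
  exact RecursiveIn.partrec_of_oracle (by simpa using hB) h

theorem setTuringLE_of_computablePred {A : Set ℕ} (B : Set ℕ) (h : ComputablePred (· ∈ A)) :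
    SetTuringLE A B :=
  (computablePred_iff_partrec_charFun.1 h).turingReducible

theorem countable_setOf_computablePred : {A : Set ℕ | ComputablePred (· ∈ A)}.Countable :=
  (countable_setOf_setTuringLE ∅).mono fun _ h => setTuringLE_of_computablePred ∅ h

/-! ### Splitting functionals -/

/-- Two functionals split on `(σ, τ)` if they give different answers on prefixes of `σ`
and `τ`. -/
def FunctionalsSplit (c d : Nat.Partrec.Code) (σ τ : List Bool) : Prop :=
  ∃ σ' τ', σ' <+: σ ∧ τ' <+: τ ∧
    ∃ n a b, a ≠ b ∧ a ∈ c.functional σ' n ∧ b ∈ d.functional τ' n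

/-- An arbitrary code need not be monotone in `σ`; allowing prefixes is what makes splitting an open
condition. -/
theorem FunctionalsSplit.mono {c d : Nat.Partrec.Code} {σ τ σ' τ' : List Bool}
    (h : FunctionalsSplit c d σ τ) (hσ : σ <+: σ') (hτ : τ <+: τ') :
    FunctionalsSplit c d σ' τ' := by
  obtain ⟨ρ, υ, hρ, hυ, H⟩ := h
  exact ⟨ρ, υ, hρ.trans hσ, hυ.trans hτ, H⟩

/-- Searching through all extensions of `σ` for a converging computation is effective. -/
theorem exists_partrec_search (c : Nat.Partrec.Code) (σ : List Bool) :
    ∃ g : ℕ →. ℕ, Partrec g ∧ (∀ n a, a ∈ g n → ∃ ρ, a ∈ c.functional (σ ++ ρ) n) ∧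
      ∀ n a ρ, a ∈ c.functional (σ ++ ρ) n → (g n).Dom := by
  -- The search parameter `t` codes a step bound and an extension of `σ`.
  let f : ℕ → ℕ → Option ℕ := fun n t =>
    Nat.Partrec.Code.evaln t.unpair.1 c
      (encode (σ ++ (decode (α := List Bool) t.unpair.2).getD [], n))
  have hf : Primrec₂ f := by
    have h₁ : Primrec fun p : ℕ × ℕ => (decode (α := List Bool) p.2.unpair.2).getD [] :=
      Primrec.option_getD.comp
        (Primrec.decode.comp (Primrec.snd.comp (Primrec.unpair.comp Primrec.snd)))
        (Primrec.const [])
    have h₂ : Primrec fun p : ℕ × ℕ =>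
        encode (σ ++ (decode (α := List Bool) p.2.unpair.2).getD [], p.1) :=
      Primrec.encode.comp
        (Primrec.pair (Primrec.list_append.comp (Primrec.const σ) h₁) Primrec.fst)
    exact Nat.Partrec.Code.primrec_evaln.comp (Primrec.pair (Primrec.pair
      (Primrec.fst.comp (Primrec.unpair.comp Primrec.snd)) (Primrec.const c)) h₂)
  refine ⟨fun n => Nat.rfindOpt (f n), Partrec.rfindOpt hf.to_comp, fun n a h => ?_,
    fun n a ρ h => ?_⟩
  · obtain ⟨t, ht⟩ := Nat.rfindOpt_spec h
    exact ⟨_, Nat.Partrec.Code.evaln_sound ht⟩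
  · obtain ⟨k, hk⟩ := Nat.Partrec.Code.evaln_complete.1 h
    refine Nat.rfindOpt_dom.2 ⟨Nat.pair k (encode ρ), a, ?_⟩
    simpa [f] using hk

/-- If two functionals never split above `(σ, τ)`, then a total function computed by both,
along sequences extending `σ` and `τ` respectively, is computable. -/
theorem partrec_of_not_functionalsSplit {c d : Nat.Partrec.Code} {X Y : ℕ → Bool} {k l : ℕ}
    (hsplit : ∀ σ τ, initialSegment X k <+: σ → initialSegment Y l <+: τ →
      ¬ FunctionalsSplit c d σ τ)
    {f : ℕ →. ℕ} (hf : ∀ n, (f n).Dom) (hX : ApproximatesAlong X c.functional f)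
    (hY : ApproximatesAlong Y d.functional f) : Partrec f := by
  obtain ⟨g, hg, hg₁, hg₂⟩ := exists_partrec_search c (initialSegment X k)
  refine hg.of_eq fun n => ?_
  obtain ⟨b, hb⟩ := Part.dom_iff_mem.1 (hf n)
  have hdom : (g n).Dom := by
    obtain ⟨m, hm, hkm⟩ := (((hX n).eventually hb).and (eventually_ge_atTop k)).exists
    obtain ⟨ρ, hρ⟩ := initialSegment_prefix X hkm
    exact hg₂ n b ρ (hρ ▸ hm)
  obtain ⟨a, ha⟩ := Part.dom_iff_mem.1 hdom
  obtain ⟨ρ, hρ⟩ := hg₁ n a ha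
  obtain ⟨m, hm, hlm⟩ := (((hY n).eventually hb).and (eventually_ge_atTop l)).exists
  -- The extension found need not lie along `X`, but its value cannot differ from the correct one,
  -- computed along `Y`.
  have hab : a = b := by
    by_contra hab
    exact hsplit _ _ (List.prefix_append _ ρ) (initialSegment_prefix Y hlm)
      ⟨_, _, List.prefix_rfl, List.prefix_rfl, n, a, b, hab, hρ, hm⟩
  rw [Part.eq_some_iff.2 ha, Part.eq_some_iff.2 hb, hab]

/-- The pair of conditions `(σ, τ)` decides whether the functionals `c` and `d` split. -/
def DecidesSplit (c d : Nat.Partrec.Code) (σ τ : List Bool) : Prop :=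
  FunctionalsSplit c d σ τ ∨ ∀ σ' τ', σ <+: σ' → τ <+: τ' → ¬ FunctionalsSplit c d σ' τ'

theorem computablePred_of_decidesSplit {X Y : ℕ → Bool}
    (h : ∀ c d, ∃ k l, DecidesSplit c d (initialSegment X k) (initialSegment Y l)) {A : Set ℕ}
    (hX : SetTuringLE A (setOfSeq X)) (hY : SetTuringLE A (setOfSeq Y)) :
    ComputablePred (· ∈ A) := by
  obtain ⟨c, hc⟩ := exists_code_approximatesAlong X hX
  obtain ⟨d, hd⟩ := exists_code_approximatesAlong Y hY
  obtain ⟨k, l, hs | hs⟩ := h c d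
  · obtain ⟨σ, τ, hσ, hτ, n, a, b, hab, ha, hb⟩ := hs
    have eq_initialSegment : ∀ {Z : ℕ → Bool} {m : ℕ} {ρ : List Bool},
        ρ <+: initialSegment Z m → ρ = initialSegment Z ρ.length := fun {Z m ρ} hρ => by
      have hlen : ρ.length ≤ m := length_initialSegment Z m ▸ hρ.length_le
      exact (List.prefix_of_prefix_length_le hρ (initialSegment_prefix Z hlen)
        (length_initialSegment Z _).ge).eq_of_length (length_initialSegment Z _).symm
    rw [eq_initialSegment hσ] at ha
    rw [eq_initialSegment hτ] at hb
    exact absurd (Part.mem_unique ((hc n).mem_iff.2 ⟨_, ha⟩) ((hd n).mem_iff.2 ⟨_, hb⟩)) hab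
  · exact computablePred_iff_partrec_charFun.2
      (partrec_of_not_functionalsSplit hs (fun n => trivial) hc hd)

/-! ### Perfect tree of mutually generic sequences -/

section Tree

variable {κ : Type*} {D : κ → List Bool → List Bool → Prop}

/-- The finitely many tasks are met one at a time; openness keeps the earlier ones met. -/
theorem exists_extension_forall_pairs {ι : Type*}
    (hmono : ∀ {k σ τ σ' τ'}, D k σ τ → σ <+: σ' → τ <+: τ' → D k σ' τ')
    (hdense : ∀ k σ τ, ∃ σ' τ', σ <+: σ' ∧ τ <+: τ' ∧ D k σ' τ')
    (S : Finset (ι × ι × κ)) (t : ι → List Bool) :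
    ∃ t' : ι → List Bool, (∀ i, t i <+: t' i) ∧
      ∀ p ∈ S, p.1 ≠ p.2.1 → D p.2.2 (t' p.1) (t' p.2.1) := by
  classical
  induction S using Finset.induction_on with
  | empty => exact ⟨t, fun _ => List.prefix_rfl, by simp⟩
  | insert p S _ ih =>
    obtain ⟨t', ht, hS⟩ := ih
    by_cases hp : p.1 = p.2.1
    · refine ⟨t', ht, fun q hq hne => ?_⟩
      rcases Finset.mem_insert.1 hq with rfl | hq
      · exact absurd hp hne
      · exact hS q hq hne
    · obtain ⟨σ, τ, hσ, hτ, hD⟩ := hdense p.2.2 (t' p.1) (t' p.2.1)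
      let t'' := Function.update (Function.update t' p.1 σ) p.2.1 τ
      have h₁ : t'' p.1 = σ := by simp [t'', Function.update_of_ne hp]
      have h₂ : t'' p.2.1 = τ := by simp [t'']
      have hext : ∀ i, t' i <+: t'' i := by
        intro i
        by_cases hi₂ : i = p.2.1
        · subst hi₂; rwa [h₂]
        by_cases hi₁ : i = p.1
        · subst hi₁; rwa [h₁]
        simp [t'', Function.update_of_ne hi₁, Function.update_of_ne hi₂]
      refine ⟨t'', fun i => (ht i).trans (hext i), fun q hq hne => ?_⟩
      rcases Finset.mem_insert.1 hq with rfl | hq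
      · rwa [h₁, h₂]
      · exact hmono (hS q hq hne) (hext _) (hext _)

theorem exists_seq_of_prefix_chain (b : ℕ → List Bool) (hb : ∀ s, b s <+: b (s + 1)) :
    ∃ X : ℕ → Bool, ∀ s, ∃ k, b s = initialSegment X k := by
  classical
  have hmono : ∀ {s t}, s ≤ t → b s <+: b t := fun {s t} h => by
    induction h with
    | refl => exact List.prefix_rfl
    | step _ ih => exact ih.trans (hb _)
  -- Positions that the chain never reaches get the value `false`.
  let X : ℕ → Bool := fun n => decide (∃ s, (b s)[n]? = some true)
  have key : ∀ s n (h : n < (b s).length), (b s)[n] = X n := by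
    intro s n h
    have hu : ∀ s' x, (b s')[n]? = some x → x = (b s)[n] := by
      intro s' x hx
      obtain ⟨h', rfl⟩ := List.getElem?_eq_some_iff.1 hx
      rcases le_total s s' with hs | hs
      · exact ((hmono hs).getElem h).symm
      · exact (hmono hs).getElem h'
    cases hx : (b s)[n] with
    | true => exact (decide_eq_true ⟨s, by simp [h, hx]⟩).symm
    | false =>
      refine (decide_eq_false ?_).symm
      rintro ⟨s', hs'⟩
      simpa [hx] using hu s' _ hs'
  refine ⟨X, fun s => ⟨(b s).length, List.ext_getElem (length_initialSegment X _).symm ?_⟩⟩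
  intro n h₁ h₂
  simp [key s n h₁, initialSegment]

/-- A Mycielski-type theorem: given countably many dense open relations on binary sequences, there
is a family of sequences, indexed by the Cantor space, any two members of which satisfy all of
the relations. -/
theorem exists_family_forall_ne [Countable κ] [Nonempty κ]
    (hmono : ∀ {k σ τ σ' τ'}, D k σ τ → σ <+: σ' → τ <+: τ' → D k σ' τ')
    (hdense : ∀ k σ τ, ∃ σ' τ', σ <+: σ' ∧ τ <+: τ' ∧ D k σ' τ') :
    ∃ X : (ℕ → Bool) → ℕ → Bool, ∀ f g, f ≠ g → ∀ k,
      ∃ m n, D k (initialSegment (X f) m) (initialSegment (X g) n) := by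
  classical
  obtain ⟨e, he⟩ := exists_surjective_nat κ
  have step : ∀ s (t : (Fin s → Bool) → List Bool), ∃ t' : (Fin (s + 1) → Bool) → List Bool,
      (∀ u, t (fun i => u i.castSucc) <+: t' u) ∧
      ∀ u v, u ≠ v → ∀ k < s + 1, D (e k) (t' u) (t' v) := by
    intro s t
    obtain ⟨t', h₁, h₂⟩ := exists_extension_forall_pairs (D := D) hmono hdense
      (Finset.univ ×ˢ Finset.univ ×ˢ (Finset.range (s + 1)).image e)
      fun u : Fin (s + 1) → Bool => t fun i => u i.castSucc
    refine ⟨t', h₁, fun u v huv k hk => h₂ (u, v, e k) ?_ huv⟩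
    simp only [Finset.mem_product, Finset.mem_univ, true_and]
    exact Finset.mem_image_of_mem e (Finset.mem_range.2 hk)
  choose next hnext₁ hnext₂ using step
  let t : ∀ s, (Fin s → Bool) → List Bool := fun s => Nat.rec (fun _ => []) next s
  have ht : ∀ f : ℕ → Bool, ∀ s, t s (fun i => f i) <+: t (s + 1) (fun i => f i) :=
    fun f s => hnext₁ s (t s) fun i => f i
  choose X hX using fun f : ℕ → Bool => exists_seq_of_prefix_chain _ (ht f)
  refine ⟨X, fun f g hfg k => ?_⟩
  obtain ⟨j, hj⟩ := Function.ne_iff.1 hfg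
  obtain ⟨k, rfl⟩ := he k
  -- At this level `f` and `g` have separated, at `j`, and requirement `k` is among those treated.
  obtain ⟨m, hm⟩ := hX f (max j k + 1)
  obtain ⟨n, hn⟩ := hX g (max j k + 1)
  refine ⟨m, n, ?_⟩
  rw [← hm, ← hn]
  refine hnext₂ _ _ _ _ (fun h => hj ?_) k (Nat.lt_succ_of_le (le_max_right j k))
  exact congrFun h ⟨j, Nat.lt_succ_of_le (le_max_left j k)⟩

end Tree

/-! ### Pairwise minimal pairs -/

/-- There is a family of pairwise distinct sequences, indexed by the Cantor space, such that any
set computable from two of them is computable. -/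
theorem exists_injective_family_minimal_pairs :
    ∃ X : (ℕ → Bool) → ℕ → Bool, Function.Injective X ∧ ∀ f g, f ≠ g → ∀ A : Set ℕ,
      SetTuringLE A (setOfSeq (X f)) → SetTuringLE A (setOfSeq (X g)) →
        ComputablePred (· ∈ A) := by
  -- The extra requirement `none` makes the sequences distinct.
  let D : Option (Nat.Partrec.Code × Nat.Partrec.Code) → List Bool → List Bool → Prop :=
    fun o σ τ => match o with
      | none => ∃ (n : ℕ) (x : Bool), σ[n]? = some x ∧ τ[n]? = some !x
      | some (c, d) => DecidesSplit c d σ τ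
  have hmono : ∀ {k σ τ σ' τ'}, D k σ τ → σ <+: σ' → τ <+: τ' → D k σ' τ' := by
    rintro (_ | ⟨c, d⟩) σ τ σ' τ' h ⟨ρ, rfl⟩ ⟨υ, rfl⟩
    · obtain ⟨n, x, h₁, h₂⟩ := h
      refine ⟨n, x, ?_, ?_⟩
      · rwa [List.getElem?_append_left (List.getElem?_eq_some_iff.1 h₁).1]
      · rwa [List.getElem?_append_left (List.getElem?_eq_some_iff.1 h₂).1]
    · rcases h with h | h
      · exact Or.inl (h.mono (List.prefix_append _ _) (List.prefix_append _ _))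
      · exact Or.inr fun σ' τ' h₁ h₂ =>
          h σ' τ' ((List.prefix_append _ _).trans h₁) ((List.prefix_append _ _).trans h₂)
  have hdense : ∀ k σ τ, ∃ σ' τ', σ <+: σ' ∧ τ <+: τ' ∧ D k σ' τ' := by
    rintro (_ | ⟨c, d⟩) σ τ
    · refine ⟨σ ++ List.replicate (τ.length + 1) true, τ ++ List.replicate (σ.length + 1) false,
        List.prefix_append _ _, List.prefix_append _ _, σ.length + τ.length, true, ?_, ?_⟩
      · simp
      · simp [List.getElem?_append]
    · by_cases h : ∃ σ' τ', σ <+: σ' ∧ τ <+: τ' ∧ FunctionalsSplit c d σ' τ'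
      · obtain ⟨σ', τ', h₁, h₂, h⟩ := h
        exact ⟨σ', τ', h₁, h₂, Or.inl h⟩
      · exact ⟨σ, τ, List.prefix_rfl, List.prefix_rfl,
          Or.inr fun σ' τ' h₁ h₂ h' => h ⟨σ', τ', h₁, h₂, h'⟩⟩
  obtain ⟨X, hX⟩ := exists_family_forall_ne (D := D) hmono hdense
  refine ⟨X, fun f g h => ?_, fun f g hfg A =>
    computablePred_of_decidesSplit fun c d => hX f g hfg (some (c, d))⟩
  by_contra hfg
  obtain ⟨m, n, i, x, h₁, h₂⟩ := hX f g hfg none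
  rw [h] at h₁
  have aux : ∀ {l y}, (initialSegment (X g) l)[i]? = some y → y = X g i := fun {l y} hy => by
    have hi := (List.getElem?_eq_some_iff.1 hy).1
    rw [length_initialSegment] at hi
    rw [getElem?_initialSegment _ hi] at hy
    exact (Option.some.inj hy).symm
  have := (aux h₁).trans (aux h₂).symm
  simp at this

/-! ### Cones and upper bounds in the degrees -/

/-- The effective join of a sequence of sets. -/
def effectiveJoin (A : ℕ → Set ℕ) : Set ℕ :=
  {p | p.unpair.2 ∈ A p.unpair.1}

theorem setTuringLE_effectiveJoin (A : ℕ → Set ℕ) (i : ℕ) :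
    SetTuringLE (A i) (effectiveJoin A) := by
  have h : Primrec fun n => Nat.pair i n := Primrec₂.natPair.comp (Primrec.const i) Primrec.id
  refine RecursiveIn.iff_nat.2 ((Nat.RecursiveIn.comp (.oracle _ (Set.mem_singleton _))
    (Primrec.nat_iff.1 h).recursiveIn).of_eq fun n => ?_)
  refine (Part.bind_some _ _).trans ?_
  by_cases hn : n ∈ A i <;> simp [charFun, effectiveJoin, hn]

theorem SetTuringDegree.deg_surjective : Function.Surjective SetTuringDegree.deg :=
  Quotient.mk_surjective

theorem SetTuringDegree.countable_Iic (a : SetTuringDegree) : (Set.Iic a).Countable := by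
  obtain ⟨B, rfl⟩ := deg_surjective a
  refine ((countable_setOf_setTuringLE B).image deg).mono fun b hb => ?_
  obtain ⟨A, rfl⟩ := deg_surjective b
  exact ⟨A, hb, rfl⟩

namespace IncomputableDegree

theorem exists_deg_eq (a : IncomputableDegree) :
    ∃ A : Set ℕ, SetTuringDegree.deg A = a.1 ∧ ¬ ComputablePred (· ∈ A) :=
  a.2

theorem countable_Iic (a : IncomputableDegree) : (Set.Iic a).Countable :=
  (SetTuringDegree.countable_Iic a.1).preimage Subtype.val_injective

theorem exists_upperBound (a : ℕ → IncomputableDegree) : ∃ b, ∀ i, a i ≤ b := by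
  choose A hA hA' using fun i => exists_deg_eq (a i)
  refine ⟨⟨SetTuringDegree.deg (effectiveJoin A), _, rfl, fun h =>
    hA' 0 ((setTuringLE_effectiveJoin A 0).computablePred h)⟩, fun i => ?_⟩
  rw [← Subtype.coe_le_coe, ← hA i]
  exact setTuringLE_effectiveJoin A i

theorem mk_le_continuum : #IncomputableDegree ≤ 𝔠 :=
  calc #IncomputableDegree ≤ #SetTuringDegree := Cardinal.mk_subtype_le _
    _ ≤ #(Set ℕ) := Cardinal.mk_le_of_surjective SetTuringDegree.deg_surjective
    _ = 𝔠 := by simp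

end IncomputableDegree

/-! ### Cardinal arithmetic in an abstract poset -/

section Poset

open Cardinal

variable {P : Type} [PartialOrder P] {T : Set P}

theorem countable_comparable_of_pairwise (hIic : ∀ q : P, (Set.Iic q).Countable)
    (hT : ∀ x ∈ T, ∀ y ∈ T, x ≠ y → ∀ q, q ≤ x → ¬ q ≤ y) (q : P) :
    {x ∈ T | x ≤ q ∨ q ≤ x}.Countable := by
  have hs : {x ∈ T | q ≤ x}.Subsingleton := fun x hx y hy => by
    by_contra hxy
    exact hT x hx.1 y hy.1 hxy q hx.2 hy.2
  refine ((hIic q).union hs.countable).mono fun x ⟨hx, h⟩ => ?_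
  exact h.imp id fun h => ⟨hx, h⟩

/-- `T` is covered by countable sets indexed by `F`. -/
theorem IsComparableFamily.mk_le {F : Set P} (hF : IsComparableFamily F)
    (hT : ∀ q : P, {x ∈ T | x ≤ q ∨ q ≤ x}.Countable) (hT' : ℵ₀ < #T) : #T ≤ #F := by
  by_contra! h
  have hsub : T ⊆ ⋃ q : F, {x ∈ T | x ≤ q.1 ∨ q.1 ≤ x} := fun x hx => by
    obtain ⟨q, hq, h⟩ := hF x
    exact Set.mem_iUnion.2 ⟨⟨q, hq⟩, hx, h⟩
  have h₁ : #T ≤ #F * ℵ₀ := (mk_le_mk_of_subset hsub).trans <| (mk_iUnion_le _).trans <| by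
    gcongr
    exact ciSup_le' fun q => (hT q.1).le_aleph0
  exact (h₁.trans (mul_le_max _ _)).not_gt (by simp [h, hT'])

theorem isIncomparableFamily_of_uncountable
    (hT : ∀ q : P, {x ∈ T | x ≤ q ∨ q ≤ x}.Countable) (hT' : ℵ₀ < #T) :
    IsIncomparableFamily T := by
  intro p
  by_contra! h
  have hsub : T ⊆ {x ∈ T | x ≤ p ∨ p ≤ x} := fun x hx =>
    ⟨hx, or_iff_not_imp_right.2 fun hpx => h x hx hpx⟩
  exact hT'.not_ge ((hT p).mono hsub).le_aleph0

theorem IsIncomparableFamily.aleph0_lt_mk [Nonempty P] {F : Set P} (hF : IsIncomparableFamily F)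
    (hP : ∀ a : ℕ → P, ∃ b, ∀ i, a i ≤ b) : ℵ₀ < #F := by
  by_contra! h
  obtain ⟨q, hq, -⟩ := hF (Classical.arbitrary P)
  have hc : F.Countable := le_aleph0_iff_set_countable.1 h
  obtain ⟨a, rfl⟩ := hc.exists_eq_range ⟨q, hq⟩
  obtain ⟨b, hb⟩ := hP a
  obtain ⟨_, ⟨i, rfl⟩, -, hi⟩ := hF b
  exact hi (hb i)

end Poset

theorem IncomputableDegree.exists_pairwise_minimal_pairs :
    ∃ T : Set IncomputableDegree, #T = 𝔠 ∧
      ∀ x ∈ T, ∀ y ∈ T, x ≠ y → ∀ q, q ≤ x → ¬ q ≤ y := by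
  obtain ⟨X, hinj, hX⟩ := exists_injective_family_minimal_pairs
  have hset : Function.Injective fun f => setOfSeq (X f) := fun f g h => hinj <| by
    funext n
    exact Bool.eq_iff_iff.2 (Set.ext_iff.1 h n)
  -- Only countably many sequences are discarded as computable.
  let S : Set (ℕ → Bool) := {f | ¬ ComputablePred (· ∈ setOfSeq (X f))}
  have hS : #S = 𝔠 := by
    have hc : Sᶜ.Countable := by
      refine (countable_setOf_computablePred.preimage hset).mono fun f hf => ?_
      exact not_not.1 hf
    have huniv : #(ℕ → Bool) = 𝔠 := by simp
    rw [← huniv]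
    have : Infinite (ℕ → Bool) := Cardinal.infinite_iff.2 (huniv ▸ Cardinal.aleph0_le_continuum)
    rw [← compl_compl S]
    exact Cardinal.mk_compl_of_infinite _
      (hc.le_aleph0.trans_lt (huniv ▸ Cardinal.aleph0_lt_continuum))
  let d : S → IncomputableDegree := fun f => ⟨SetTuringDegree.deg (setOfSeq (X f)), _, rfl, f.2⟩
  have hd : ∀ f g : S, f ≠ g → ∀ q, q ≤ d f → ¬ q ≤ d g := by
    intro f g hfg q hf hg
    obtain ⟨A, hA, hA'⟩ := q.exists_deg_eq
    rw [← Subtype.coe_le_coe, ← hA] at hf hg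
    exact hA' (hX f g (fun h => hfg (Subtype.ext h)) A hf hg)
  have hdinj : Function.Injective d := fun f g h => by
    by_contra hfg
    exact hd f g hfg (d f) le_rfl h.le
  refine ⟨Set.range d, (Cardinal.mk_range_eq d hdinj).trans hS, ?_⟩
  rintro _ ⟨f, rfl⟩ _ ⟨g, rfl⟩ hfg
  exact hd f g fun h => hfg (h ▸ rfl)

theorem mainTheorem10 :
    comparabilityNumber IncomputableDegree = 𝔠 ∧
      (∃ F : Set IncomputableDegree, IsIncomparableFamily F) ∧
      incomparabilityNumber IncomputableDegree = ℵ₁ := by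
  obtain ⟨T, hT, hpair⟩ := IncomputableDegree.exists_pairwise_minimal_pairs
  have hcount := countable_comparable_of_pairwise IncomputableDegree.countable_Iic hpair
  have hTunc : ℵ₀ < #T := hT ▸ Cardinal.aleph0_lt_continuum
  have hne : Nonempty IncomputableDegree := by
    obtain ⟨x, -⟩ := Cardinal.mk_ne_zero_iff.1 (ne_zero_of_lt hTunc)
    exact ⟨x⟩
  obtain ⟨T₁, hsub, hT₁⟩ := Cardinal.le_mk_iff_exists_subset.1
    (Cardinal.aleph_one_le_continuum.trans hT.ge)
  have hinc : IsIncomparableFamily T₁ := isIncomparableFamily_of_uncountable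
    (countable_comparable_of_pairwise IncomputableDegree.countable_Iic
      fun x hx y hy => hpair x (hsub hx) y (hsub hy))
    (hT₁ ▸ Cardinal.aleph0_lt_aleph_one)
  have huniv : IsComparableFamily (Set.univ : Set IncomputableDegree) :=
    fun p => ⟨p, trivial, Or.inl le_rfl⟩
  have huniv : IsComparableFamily (Set.univ : Set IncomputableDegree) :=
    fun p => ⟨p, trivial, Or.inl le_rfl⟩
  have huniv : IsComparableFamily (Set.univ : Set IncomputableDegree) :=
    fun p => ⟨p, trivial, Or.inl le_rfl⟩
  refine ⟨le_antisymm ?_ (le_csInf ?_ ?_), ⟨T₁, hinc⟩, le_antisymm ?_ (le_csInf ?_ ?_)⟩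
  · have h : comparabilityNumber IncomputableDegree ≤ #(Set.univ : Set IncomputableDegree) :=
      csInf_le' ⟨Set.univ, huniv, rfl⟩
    rw [Cardinal.mk_univ] at h
    exact h.trans IncomputableDegree.mk_le_continuum
  · exact ⟨_, Set.univ, huniv, rfl⟩
  · rintro _ ⟨F, hF, rfl⟩
    exact hT ▸ hF.mk_le hcount hTunc
  · exact csInf_le' ⟨T₁, hinc, hT₁⟩
  · exact ⟨_, T₁, hinc, rfl⟩
  · rintro _ ⟨F, hF, rfl⟩
    rw [← Cardinal.succ_aleph0, Order.succ_le_iff]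
    exact hF.aleph0_lt_mk IncomputableDegree.exists_upperBound
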